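/- Let $N$ be a set of $n$ candidates with strictly positive, pairwise distinct weights, and let $1\le r\le n/2$. The feasible solutions are the sets of at most $r$ candidates, i.e. the independent sets of the uniform matroid of rank $r$ on $N$; the matroid is known upfront, whereas the weight of a candidate is revealed when the candidate arrives for the first time. Initially all candidates are in a pool of undecided candidates. As long as the pool is non-empty, in each time step a candidate drawn uniformly at random from the pool, independently of the past, arrives. Upon each arrival, the algorithm MaintainOPT for the known matroid decides as follows, where $K$ is the set of all candidates that have arrived so far (including the present one) and $I_K^*$ is the maximum-weight independent subset of $K$: every candidate in $K\setminus I_K^*$ is rejected; every candidate $e\in I_K^*$ that cannot be forced out of the optimum by the candidates that have not arrived (i.e. for all possible weights of the candidates in $N\setminus K$ that keep all weights positive and pairwise distinct, $e$ belongs to the maximum-weight independent subset of $N$) is accepted. Decided candidates leave the pool, all others stay in the pool. The arriving candidate is postponed if it is still undecided after this step. For $1\le j\le n$ let $R_j$ be the total number of times that the $j$-th best candidate (the one with the $j$-th largest weight) is postponed. Then there is a universal constant $C$, independent of $n$, $r$, $j$ and the weights, such that \[ \mathbb{E}[R_j]\;\le\; \begin{cases} \ln\!\left(\dfrac{n-j}{r-j+1}\right)+C,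 & j=1,\dots,r,\\[2ex] \ln\!\left(\dfrac{j-1}{j-r}\right)+C, & j=r+1,\dots,n. \end{cases} \] -/

import Mathlib

open MeasureTheory ProbabilityTheory
open scoped ENNReal

namespace Postponing

section Matroids

variable {N : Type*} [DecidableEq N]

/-- The uniform matroid of rank `r` on the set `N` of all candidates (for `r ≤ |N|`): a set is
independent iff it has at most `r` elements. -/
def uniformMatroid (N : Type*) [DecidableEq N] (r : ℕ) : Matroid N :=
  (IndepMatroid.ofFinset Set.univ (fun I : Finset N => I.card ≤ r)
    (show (∅ : Finset N).card ≤ r by simp)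
    (fun _ _ hJ hIJ => (Finset.card_le_card hIJ).trans hJ)
    (fun I J _ hJ hIJ => by
      obtain ⟨e, heJ, heI⟩ := Finset.exists_mem_notMem_of_card_lt_card hIJ
      exact ⟨e, heJ, heI, by rw [Finset.card_insert_of_notMem heI]; omega⟩)
    (fun _ _ => Set.subset_univ _)).matroid

theorem uniformMatroid_indep (r : ℕ) (I : Finset N) :
    (uniformMatroid N r).Indep (I : Set N) ↔ I.card ≤ r := by
  change (∀ J : Finset N, (J : Set N) ⊆ (I : Set N) → J.card ≤ r) ↔ I.card ≤ r
  exact ⟨fun h => h I subset_rfl,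
    fun h J hJ => (Finset.card_le_card (Finset.coe_subset.1 hJ)).trans h⟩

end Matroids

section Algorithm

variable {N : Type*} [Fintype N] [DecidableEq N]

/-- Admissible weights: strictly positive and pairwise distinct. -/
def Admissible (w : N → ℝ) : Prop :=
  (∀ e, 0 < w e) ∧ Function.Injective w

/-- `I` is an independent set of maximum weight among the independent subsets of `K`.
For admissible weights it is unique. -/
def IsOptimum (M : Matroid N) (w : N → ℝ) (K I : Finset N) : Prop :=
  I ⊆ K ∧ M.Indep (I : Set N) ∧
    ∀ J : Finset N, J ⊆ K → M.Indep (J : Set N) → ∑ e ∈ J, w e ≤ ∑ e ∈ I, w e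

/-- When exactly the weights of the candidates in `K` are known, the candidate `e` can still be
forced out of the optimum: some admissible weights `w'` that agree with the revealed weights
yield an optimum over all candidates which does not contain `e`. -/
def CanBeForcedOut (M : Matroid N) (w : N → ℝ) (K : Finset N) (e : N) : Prop :=
  ∃ w' : N → ℝ, Admissible w' ∧ (∀ f ∈ K, w' f = w f) ∧
    ∃ I : Finset N, IsOptimum M w' Finset.univ I ∧ e ∉ I

open Classical in
/-- The candidates that MaintainOPT with known matroid `M` has not decided when exactly the
candidates in `K` have arrived. A candidate that has not arrived is undecided. A candidate of `K`
outside the optimum of `K` is rejected; a candidate in the optimum of `K` that cannot be forced out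
any more is accepted; every other candidate of `K` is undecided. (Decisions persist: both the
property of being rejected and that of being accepted are preserved when `K` grows.) -/
noncomputable def undecided (M : Matroid N) (w : N → ℝ) (K : Finset N) : Finset N :=
  Finset.univ.filter fun e =>
    e ∉ K ∨ ((∃ I : Finset N, IsOptimum M w K I ∧ e ∈ I) ∧ CanBeForcedOut M w K e)

theorem mem_undecided (M : Matroid N) (w : N → ℝ) (K : Finset N) (e : N) :
    e ∈ undecided M w K ↔
      e ∉ K ∨ ((∃ I : Finset N, IsOptimum M w K I ∧ e ∈ I) ∧ CanBeForcedOut M w K e) := by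
  simp [undecided]

end Algorithm

section Arrivals

/-- The outcome of one time step: `some e` if candidate `e` arrives, and `none` if the pool of
undecided candidates is empty, so that nobody arrives. -/
def Arrival (N : Type*) : Type _ := Option N

instance (N : Type*) : MeasurableSpace (Arrival N) := ⊤

instance (N : Type*) : DiscreteMeasurableSpace (Arrival N) := ⟨fun _ => trivial⟩

instance (N : Type*) [Finite N] : Finite (Arrival N) :=
  inferInstanceAs (Finite (Option N))

variable {N : Type*} [Fintype N] [DecidableEq N]

open Classical in
/-- A uniformly random candidate from the pool `P` arrives. -/
noncomputable def drawFrom (P : Finset N) : PMF (Arrival N) :=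
  if h : P.Nonempty then (PMF.uniformOfFinset P h).map (fun e => (some e : Option N))
  else PMF.pure (none : Option N)

open Classical in
/-- The set of candidates that arrive at least once in the time steps `0, …, t`. -/
noncomputable def arrived {t : ℕ} (h : (i : Finset.Iic t) → Arrival N) : Finset N :=
  Finset.univ.filter fun e => ∃ i, h i = (some e : Option N)

/-- Law of the arrival in step `t + 1` given the arrivals in the steps `0, …, t`: a uniformly
random candidate from the current pool of undecided candidates. -/
noncomputable def nextArrival (M : Matroid N) (w : N → ℝ) (t : ℕ) :
    Kernel ((i : Finset.Iic t) → Arrival N) (Arrival N) :=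
  Kernel.ofFunOfCountable fun h => (drawFrom (undecided M w (arrived h))).toMeasure

instance (M : Matroid N) (w : N → ℝ) (t : ℕ) : IsMarkovKernel (nextArrival M w t) :=
  ⟨fun h => inferInstanceAs
    (IsProbabilityMeasure (drawFrom (undecided M w (arrived h))).toMeasure)⟩

/-- The law of the whole sequence of arrivals `ω 0, ω 1, …` under MaintainOPT with known matroid
`M` and weights `w`. At the start all candidates are in the pool. -/
noncomputable def arrivalLaw (M : Matroid N) (w : N → ℝ) : Measure (ℕ → Arrival N) :=
  Kernel.trajMeasure (X := fun _ => Arrival N)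
    (drawFrom (Finset.univ : Finset N)).toMeasure (nextArrival M w)

instance (M : Matroid N) (w : N → ℝ) : IsProbabilityMeasure (arrivalLaw M w) := by
  unfold arrivalLaw; infer_instance

open Classical in
/-- The number of postponements of the candidate `e`: the number of time steps in which `e` arrives
and is left undecided by the algorithm (which already takes this arrival into account). -/
noncomputable def postponements (M : Matroid N) (w : N → ℝ) (e : N) (ω : ℕ → Arrival N) : ℝ≥0∞ :=
  ∑' t : ℕ,
    if ω t = (some e : Option N) ∧
        e ∈ undecided M w (arrived fun i : Finset.Iic t => ω i) then 1 else 0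

/-- The expected number of postponements of the candidate `e`. -/
noncomputable def expectedPostponements (M : Matroid N) (w : N → ℝ) (e : N) : ℝ≥0∞ :=
  ∫⁻ ω, postponements M w e ω ∂(arrivalLaw M w)

/-- The position of `e` in the order by decreasing weight: `e` is the `position w e`-th best
candidate. -/
noncomputable def position (w : N → ℝ) (e : N) : ℕ :=
  (Finset.univ.filter fun f => w e < w f).card + 1

end Arrivals

end Postponing

/-!
Whether a candidate `e` is undecided depends only on the set `K` of the candidates that have
arrived. An unseen candidate is always in the pool, so if `q` candidates are unseen, each of them is
as likely to arrive next as `e` is, and an undecided `e ∈ K` arrives on average `1 / q` times before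
the next new candidate does. The unseen candidates other than `e` form a uniformly random set, so,
apart from its first arrival, `e` is postponed on average at most `∑ q, (1 / q) * P(e is undecided when
q candidates are unseen)` times.

If the `j`-th best candidate is undecided, then some candidates are still missing: for `j ≤ r` at
least `a = r - j + 1` of the `s = n - j` worse ones are unseen
(`le_card_better_add_of_undecided`), and for `r < j` at least `a = j - r` of the `s = j - 1` better
ones are (`card_better_lt_of_undecided`). The mean number of unseen ones of these `s` candidates is
`q * s / (n - 1)`. The probability above is therefore at most `q * s / ((n - 1) * a)` by Markov's
inequality, and at most `1`. Using the former up to `q = (n - 1) * a / s` and the latter from there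
on bounds the sum by `log (s / a)` plus a constant, which may be taken to be `3`.

The proof avoids the distribution of the random set of unseen candidates. The bound just described,
with `n - 1` and `s` replaced by the current numbers of unseen candidates, is an explicit function
of `K` (`potential`). In each step it decreases in expectation by at least the probability that `e`
is postponed (`potential_drift`), so its initial value is a bound for the expected number of
postponements (`expectedPostponements_le_of_supermartingale`). This is combined in
`expectedPostponements_le_log`.
-/

namespace Postponing

/-! ### Supermartingale bounds for the arrival process -/

section SupermartingaleBound

variable {N : Type*}

/-- The outcome of a time step in which `f` arrives. -/
def candidate (f : N) : Arrival N := (some f : Option N)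

/-- The outcome of a time step in which nobody arrives. -/
def nobody (N : Type*) : Arrival N := (none : Option N)

theorem candidate_inj {f g : N} : candidate f = candidate g ↔ f = g := Option.some_inj

theorem nobody_ne_candidate (f : N) : nobody N ≠ candidate f := nofun

variable [Fintype N]

theorem mem_arrived {t : ℕ} (h : (i : Finset.Iic t) → Arrival N) (f : N) :
    f ∈ arrived h ↔ ∃ i, h i = candidate f := by
  simp only [arrived, Finset.mem_filter, Finset.mem_univ, true_and]
  rfl

variable [DecidableEq N]

open Classical in
/-- The set of arrived candidates after the outcome `x` of a time step, if it was `K` before. -/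
noncomputable def afterArrival (K : Finset N) (x : Arrival N) : Finset N :=
  K ∪ Finset.univ.filter fun f => x = candidate f

open Classical in
/-- The indicator that `e` is postponed in a time step with outcome `x`, where `K` is the set of
the candidates that arrived before this step. -/
noncomputable def postponedAt (M : Matroid N) (w : N → ℝ) (e : N) (K : Finset N) (x : Arrival N) :
    ℝ≥0∞ :=
  if x = candidate e ∧ e ∈ undecided M w (afterArrival K x) then 1 else 0

theorem arrived_zero (ω : ℕ → Arrival N) :
    arrived (fun i : Finset.Iic 0 => ω i) = afterArrival ∅ (ω 0) := by
  ext f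
  simp [mem_arrived, afterArrival]

theorem arrived_succ (ω : ℕ → Arrival N) (t : ℕ) :
    arrived (fun i : Finset.Iic (t + 1) => ω i) =
      afterArrival (arrived fun i : Finset.Iic t => ω i) (ω (t + 1)) := by
  ext f
  simp only [mem_arrived, afterArrival, Finset.mem_filter, Finset.mem_univ, true_and,
    Finset.mem_union, Subtype.exists, Finset.mem_Iic, exists_prop]
  constructor
  · rintro ⟨i, hi, h⟩
    rcases Nat.le_succ_iff.1 hi with hi | rfl
    exacts [Or.inl ⟨i, hi, h⟩, Or.inr h]
  · rintro (⟨i, hi, h⟩ | h)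
    exacts [⟨i, hi.trans t.le_succ, h⟩, ⟨t + 1, le_rfl, h⟩]

theorem undecided_empty (M : Matroid N) (w : N → ℝ) : undecided M w ∅ = Finset.univ := by
  ext f
  simp [mem_undecided]

theorem arrivalLaw_map_eval_zero (M : Matroid N) (w : N → ℝ) :
    (arrivalLaw M w).map (fun ω => ω 0) = (drawFrom (Finset.univ : Finset N)).toMeasure := by
  have h : (fun ω : ℕ → Arrival N => ω 0) =
      (fun h : (i : Finset.Iic 0) → Arrival N => h ⟨0, by simp⟩) ∘
        Preorder.frestrictLe (π := fun _ => Arrival N) 0 := rfl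
  rw [h, ← Measure.map_map (by fun_prop) (by fun_prop), arrivalLaw, Kernel.trajMeasure,
    Measure.map_comp _ _ (by fun_prop), Kernel.traj_map_frestrictLe, Kernel.partialTraj_self,
    Measure.id_comp, Measure.map_map (by fun_prop) (by fun_prop)]
  exact Measure.map_id

theorem lintegral_arrivalLaw_zero (M : Matroid N) (w : N → ℝ) (F : Arrival N → ℝ≥0∞) :
    ∫⁻ ω, F (ω 0) ∂arrivalLaw M w =
      ∫⁻ x, F x ∂(drawFrom (Finset.univ : Finset N)).toMeasure := by
  rw [← arrivalLaw_map_eval_zero M w, lintegral_map (measurable_of_finite F) (by fun_prop)]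

/-- Markov property: the set of arrived candidates determines the law of the next arrival. -/
theorem lintegral_arrivalLaw_succ (M : Matroid N) (w : N → ℝ) (t : ℕ)
    (F : Finset N → Arrival N → ℝ≥0∞) :
    ∫⁻ ω, F (arrived fun i : Finset.Iic t => ω i) (ω (t + 1)) ∂arrivalLaw M w =
      ∫⁻ ω, ∫⁻ x, F (arrived fun i : Finset.Iic t => ω i) x
        ∂(drawFrom (undecided M w (arrived fun i : Finset.Iic t => ω i))).toMeasure
        ∂arrivalLaw M w := by
  have h := Kernel.map_frestrictLe_trajMeasure_compProd_eq_map_trajMeasure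
    (X := fun _ => Arrival N) (μ₀ := (drawFrom (Finset.univ : Finset N)).toMeasure)
    (κ := nextArrival M w) (a := t)
  have h' := congrArg (fun μ => ∫⁻ p, F (arrived p.1) p.2 ∂μ) h
  rw [Measure.lintegral_compProd (measurable_of_finite _),
    lintegral_map (measurable_of_finite _) (by fun_prop),
    lintegral_map (measurable_of_finite _) (by fun_prop)] at h'
  exact h'.symm

/-- A function of the set of arrived candidates that decreases in expectation, in each step, by at
least the probability that `e` is postponed bounds the expected number of postponements. -/
theorem expectedPostponements_le_of_supermartingale (M : Matroid N) (w : N → ℝ) (e : N)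
    (V : Finset N → ℝ≥0∞)
    (hV : ∀ K, ∫⁻ x, (postponedAt M w e K x + V (afterArrival K x))
      ∂(drawFrom (undecided M w K)).toMeasure ≤ V K) :
    expectedPostponements M w e ≤ V ∅ := by
  classical
  have hm : ∀ (t : ℕ) (g : ((i : Finset.Iic t) → Arrival N) → ℝ≥0∞),
      Measurable fun ω : ℕ → Arrival N => g fun i : Finset.Iic t => ω i := fun t g =>
    (measurable_of_finite g).comp (Preorder.measurable_frestrictLe (X := fun _ => Arrival N) t)
  let R : ℕ → (ℕ → Arrival N) → ℝ≥0∞ := fun t ω =>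
    if ω t = candidate e ∧
      e ∈ undecided M w (arrived fun i : Finset.Iic t => ω i) then 1 else 0
  have hR : ∀ t, Measurable (R t) := fun t =>
    hm t fun h => if h ⟨t, by simp⟩ = candidate e ∧ e ∈ undecided M w (arrived h)
      then 1 else 0
  have key : ∀ t, ∑ s ∈ Finset.range (t + 1), ∫⁻ ω, R s ω ∂arrivalLaw M w +
      ∫⁻ ω, V (arrived fun i : Finset.Iic t => ω i) ∂arrivalLaw M w ≤ V ∅ := by
    intro t
    induction t with
    | zero =>
      rw [Finset.sum_range_one, ← lintegral_add_left (hR 0)]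
      refine le_trans (le_of_eq ?_) (hV ∅)
      rw [undecided_empty, ← lintegral_arrivalLaw_zero M w]
      simp only [R, arrived_zero, postponedAt]
    | succ t ih =>
      rw [Finset.sum_range_succ, add_assoc, ← lintegral_add_left (hR (t + 1))]
      refine le_trans (add_le_add le_rfl ?_) ih
      have h := lintegral_arrivalLaw_succ M w t
        (fun K x => postponedAt M w e K x + V (afterArrival K x))
      simp only [postponedAt, ← arrived_succ] at h
      exact h.le.trans (lintegral_mono fun ω => hV _)
  have hE : expectedPostponements M w e = ∫⁻ ω, ∑' t, R t ω ∂arrivalLaw M w := rfl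
  rw [hE, lintegral_tsum fun t => (hR t).aemeasurable]
  refine ENNReal.tsum_le_of_sum_range_le fun t => ?_
  exact (Finset.sum_le_sum_of_subset (Finset.range_mono t.le_succ)).trans
    (le_self_add.trans (key t))

theorem afterArrival_candidate (K : Finset N) (f : N) :
    afterArrival K (candidate f) = insert f K := by
  ext g
  simp only [afterArrival, Finset.mem_union, Finset.mem_filter, Finset.mem_univ, true_and,
    Finset.mem_insert, candidate_inj]
  rw [or_comm, eq_comm]

theorem afterArrival_nobody (K : Finset N) : afterArrival K (nobody N) = K := by
  ext g
  simp [afterArrival, nobody_ne_candidate]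

omit [Fintype N] [DecidableEq N] in
theorem drawFrom_empty : drawFrom (∅ : Finset N) = PMF.pure (nobody N) := by
  rw [drawFrom, dif_neg (by simp)]
  rfl

omit [Fintype N] [DecidableEq N] in
theorem drawFrom_of_nonempty (P : Finset N) (hP : P.Nonempty) :
    drawFrom P = (PMF.uniformOfFinset P hP).map candidate := by
  rw [drawFrom, dif_pos hP]
  rfl

omit [DecidableEq N] in
theorem lintegral_drawFrom (P : Finset N) (hP : P.Nonempty) (F : Arrival N → ℝ≥0∞) :
    ∫⁻ x, F x ∂(drawFrom P).toMeasure = (∑ f ∈ P, F (candidate f)) * (P.card : ℝ≥0∞)⁻¹ := by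
  let _ : MeasurableSpace N := ⊤
  have hm : Measurable (candidate : N → Arrival N) := fun _ _ => trivial
  rw [drawFrom_of_nonempty P hP, ← PMF.toMeasure_map _ _ hm,
    lintegral_map (measurable_of_finite F) hm, lintegral_fintype, Finset.sum_mul,
    ← Finset.sum_subset (Finset.subset_univ P)]
  · refine Finset.sum_congr rfl fun f hf => ?_
    rw [PMF.toMeasure_apply_singleton _ _ MeasurableSpace.measurableSet_top, PMF.uniformOfFinset_apply_of_mem hP hf]
  · intro f _ hf
    rw [PMF.toMeasure_apply_singleton _ _ MeasurableSpace.measurableSet_top, PMF.uniformOfFinset_apply_of_notMem hP hf,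
      mul_zero]

open Classical in
/-- It suffices to test the supermartingale property of `V` against the unseen candidates, although
the arrival is drawn from the whole pool: the arrival of a candidate of `K` does not change the set
of arrived candidates. If `e ∈ K` is undecided, it accounts for the second summand with its own
arrival; if `e ∉ K`, it does so with its first arrival. -/
theorem expectedPostponements_le (M : Matroid N) (w : N → ℝ) (e : N)
    (V : Finset N → ℝ) (hV0 : ∀ K, 0 ≤ V K)
    (hV : ∀ K, ∑ f ∈ Kᶜ, V (insert f K) +
      (if e ∈ undecided M w (insert e K) then 1 else 0) ≤ Kᶜ.card * V K) :
    expectedPostponements M w e ≤ ENNReal.ofReal (V ∅) := by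
  refine expectedPostponements_le_of_supermartingale M w e (fun K => ENNReal.ofReal (V K)) ?_
  intro K
  rcases (undecided M w K).eq_empty_or_nonempty with hP | hP
  · rw [hP, drawFrom_empty, PMF.toMeasure_pure, lintegral_dirac, afterArrival_nobody]
    simp [postponedAt, nobody_ne_candidate]
  set P := undecided M w K with hPdef
  have hsub : Kᶜ ⊆ P := fun f hf => by
    rw [hPdef, mem_undecided]; exact Or.inl (by simpa using hf)
  let u : ℝ := if e ∈ undecided M w (insert e K) then 1 else 0
  have hu : 0 ≤ u := by dsimp only [u]; split_ifs <;> norm_num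
  have hF : ∀ f, postponedAt M w e K (candidate f) +
      ENNReal.ofReal (V (afterArrival K (candidate f))) =
      ENNReal.ofReal ((if f = e then u else 0) + V (insert f K)) := by
    intro f
    rw [postponedAt, afterArrival_candidate, candidate_inj]
    by_cases hfe : f = e
    · subst hfe
      dsimp only [u]
      split_ifs with h1 <;> simp_all [ENNReal.ofReal_add]
    · simp [hfe]
  have hsum : ∑ f ∈ P, ((if f = e then u else 0) + V (insert f K)) ≤ P.card * V K := by
    have h1 : ∑ f ∈ P, V (insert f K) =
        ∑ f ∈ Kᶜ, V (insert f K) + ((P.card : ℝ) - Kᶜ.card) * V K := by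
      rw [← Finset.sum_sdiff hsub, add_comm, ← Nat.cast_sub (Finset.card_le_card hsub),
        ← Finset.card_sdiff_of_subset hsub, ← nsmul_eq_mul, ← Finset.sum_const]
      congr 1
      refine Finset.sum_congr rfl fun f hf => ?_
      have : f ∈ K := by simpa using (Finset.mem_sdiff.1 hf).2
      rw [Finset.insert_eq_of_mem this]
    have h2 : ∑ f ∈ P, (if f = e then u else 0) ≤ u := by
      rw [Finset.sum_ite_eq']; split_ifs <;> linarith
    rw [Finset.sum_add_distrib, h1]
    have := hV K
    linarith
  rw [lintegral_drawFrom P hP, Finset.sum_congr rfl fun f _ => hF f,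
    ← ENNReal.ofReal_sum_of_nonneg fun f _ => add_nonneg (by split_ifs <;> simp [hu]) (hV0 _)]
  refine (mul_le_mul_left (ENNReal.ofReal_le_ofReal hsum) _).trans ?_
  rw [ENNReal.ofReal_mul (Nat.cast_nonneg _), ENNReal.ofReal_natCast, mul_comm, ← mul_assoc,
    ENNReal.inv_mul_cancel (by simpa using hP.ne_empty) (ENNReal.natCast_ne_top _), one_mul]
end SupermartingaleBound

/-! ### A potential for the unseen candidates -/

section Potential

/-- The potential of `q` unseen candidates, `g` of which lie in a given set: a bound for
`∑ i < q, (1 / (i + 1)) * min 1 (μ i / a)`, where `μ i = (g / q) * (i + 1)` is the mean number of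
candidates of the set among `i + 1` random ones of the `q` candidates. The minimum is replaced by
`1` for `t ≤ i` and by `μ i / a` for `i < t`, which makes the potential affine in `g`. -/
noncomputable def potential (t a q g : ℕ) : ℝ :=
  ∑ i ∈ Finset.Ico t q, 1 / ((i : ℝ) + 1) + (min q t : ℕ) / (q : ℝ) * ((g : ℝ) / a)

theorem potential_nonneg (t a q g : ℕ) : 0 ≤ potential t a q g := by
  unfold potential; positivity

/-- The potential decreases in expectation by at least `u / (p + 1)` when a uniformly random one of
the `p + 1` unseen candidates is revealed. -/
theorem potential_drift (t a p g : ℕ) (ha : 1 ≤ a) {u : ℝ} (hu : u ≤ 1) (hua : u * a ≤ g) :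
    g * potential t a p (g - 1) + ((p + 1 : ℕ) - (g : ℝ)) * potential t a p g + u ≤
      (p + 1 : ℕ) * potential t a (p + 1) g := by
  have ha' : (0 : ℝ) < a := by exact_mod_cast ha
  have hua' : u ≤ g / a := (le_div_iff₀ ha').2 hua
  have hg : (g : ℝ) * ((g - 1 : ℕ) : ℝ) = g * (g - 1) := by
    rcases g with _ | g <;> simp
  have hp1 : (0 : ℝ) < p + 1 := by positivity
  -- the mean of the affine part after one step
  have hlin : ∀ S c : ℝ, g * (S + c * (((g - 1 : ℕ) : ℝ) / a)) +
      ((p + 1 : ℕ) - (g : ℝ)) * (S + c * (g / a)) = (p + 1) * S + c * p * (g / a) := by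
    intro S c
    push_cast
    linear_combination (c / a) * hg
  unfold potential
  rw [hlin]
  rcases le_or_gt t p with h | h
  · rw [Finset.sum_Ico_succ_top h, min_eq_right h, min_eq_right (h.trans p.le_succ)]
    have h1 : (t : ℝ) / p * p ≤ t := by
      rcases p.eq_zero_or_pos with rfl | hp
      · simp
      · rw [div_mul_cancel₀ _ (by positivity)]
    have h2 := mul_le_mul_of_nonneg_right h1 (show (0 : ℝ) ≤ g / a by positivity)
    push_cast
    rw [mul_add, mul_add, mul_one_div_cancel hp1.ne', ← mul_assoc, mul_div_cancel₀ _ hp1.ne']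
    linarith
  · rw [Finset.Ico_eq_empty (by omega), Finset.Ico_eq_empty (by omega), min_eq_left h.le,
      min_eq_left (by omega)]
    have h1 : (p : ℝ) / p * p = p := div_mul_cancel_of_imp id
    rw [h1]
    push_cast
    rw [div_self hp1.ne']
    simp only [Finset.sum_empty]
    linarith

theorem sum_Ico_one_div_le_log {t m : ℕ} (ht : 1 ≤ t) (htm : t ≤ m) :
    ∑ i ∈ Finset.Ico t m, 1 / ((i : ℝ) + 1) ≤ Real.log (m / t) := by
  have ht' : (0 : ℝ) < t := by exact_mod_cast ht
  induction m, htm using Nat.le_induction with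
  | base => simp [ht'.ne']
  | succ m htm ih =>
    have hm : (0 : ℝ) < m := ht'.trans_le (by exact_mod_cast htm)
    have h := Real.one_sub_inv_le_log_of_pos (show (0 : ℝ) < (m + 1) / m by positivity)
    have h2 : 1 - (((m : ℝ) + 1) / m)⁻¹ = 1 / (m + 1) := by
      rw [inv_div]; field_simp; ring
    have h3 : Real.log (((m + 1 : ℕ) : ℝ) / t) = Real.log (m / t) + Real.log ((m + 1) / m) := by
      rw [← Real.log_mul (by positivity) (by positivity)]
      congr 1
      push_cast
      field_simp
    rw [Finset.sum_Ico_succ_top htm, h3]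
    linarith

/-- The threshold `t` is where the mean `(s / m) * t` reaches `a`: below it the affine part adds up
to at most `2`, above it the harmonic part is at most `log (m / t) ≤ log (s / a)`. -/
theorem potential_le_log {a s m : ℕ} (ha : 1 ≤ a) (has : a ≤ s) (hsm : s ≤ m) :
    potential ⌈(a * m : ℝ) / s⌉₊ a m s ≤ Real.log ((s : ℝ) / a) + 2 := by
  have ha' : (0 : ℝ) < a := by exact_mod_cast ha
  have has' : (a : ℝ) ≤ s := by exact_mod_cast has
  have hsm' : (s : ℝ) ≤ m := by exact_mod_cast hsm
  have hs' : (0 : ℝ) < s := ha'.trans_le has'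
  have hm' : (0 : ℝ) < m := hs'.trans_le hsm'
  set t := ⌈(a * m : ℝ) / s⌉₊ with ht
  have hlow : (a * m : ℝ) / s ≤ t := Nat.le_ceil _
  have hupp : (t : ℝ) < a * m / s + 1 := Nat.ceil_lt_add_one (by positivity)
  have ht1 : 1 ≤ t := Nat.one_le_ceil_iff.2 (by positivity)
  have htm : t ≤ m := Nat.ceil_le.2 <| by
    rw [div_le_iff₀ hs', mul_comm]
    exact mul_le_mul_of_nonneg_left has' hm'.le
  have ht' : (0 : ℝ) < t := by exact_mod_cast ht1
  have h1 : Real.log ((m : ℝ) / t) ≤ Real.log (s / a) := by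
    refine Real.log_le_log (by positivity) ?_
    rw [div_le_div_iff₀ ht' ha']
    rw [div_le_iff₀ hs'] at hlow
    linarith
  have h2 : (t : ℝ) / m * (s / a) ≤ 2 := by
    rw [div_mul_div_comm, div_le_iff₀ (by positivity)]
    have h3 : (t : ℝ) * s ≤ a * m + s := by
      have := mul_le_mul_of_nonneg_right hupp.le hs'.le
      rwa [add_mul, div_mul_cancel₀ _ hs'.ne', one_mul] at this
    have h4 : (m : ℝ) ≤ m * a := le_mul_of_one_le_right hm'.le (by exact_mod_cast ha)
    linarith
  unfold potential
  rw [min_eq_right htm]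
  linarith [sum_Ico_one_div_le_log ht1 htm]

variable {N : Type*} [Fintype N] [DecidableEq N]

/-- The drift inequality for sets: `L` is the set of seen candidates, and `G \ L` the unseen part of
the set `G` that the potential keeps track of. -/
theorem sum_potential_insert_le (G L : Finset N) (t a : ℕ) (ha : 1 ≤ a) {u : ℝ} (hu : u ≤ 1)
    (hua : u * a ≤ (G \ L).card) :
    ∑ f ∈ Lᶜ, potential t a (insert f L)ᶜ.card (G \ insert f L).card + u ≤
      Lᶜ.card * potential t a Lᶜ.card (G \ L).card := by
  have hsub : G \ L ⊆ Lᶜ := fun f hf => by simpa using (Finset.mem_sdiff.1 hf).2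
  rcases hq : Lᶜ.card with _ | p
  · rw [Finset.card_eq_zero] at hq
    rw [hq, Finset.subset_empty] at hsub
    rw [hsub] at hua
    have ha' : (0 : ℝ) < a := by exact_mod_cast ha
    have : u ≤ 0 := le_of_mul_le_mul_right (by simpa using hua) ha'
    simpa [hq] using this
  have hcard : ∀ f ∈ Lᶜ, (insert f L)ᶜ.card = p := fun f hf => by
    rw [Finset.compl_insert, Finset.card_erase_of_mem hf, hq, Nat.add_sub_cancel]
  have h1 : ∀ f ∈ G \ L, potential t a (insert f L)ᶜ.card (G \ insert f L).card =
      potential t a p ((G \ L).card - 1) := fun f hf => by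
    rw [hcard f (hsub hf), Finset.sdiff_insert, Finset.card_erase_of_mem hf]
  have h2 : ∀ f ∈ Lᶜ \ (G \ L), potential t a (insert f L)ᶜ.card (G \ insert f L).card =
      potential t a p (G \ L).card := fun f hf => by
    rw [Finset.mem_sdiff] at hf
    rw [hcard f hf.1, Finset.sdiff_insert, Finset.erase_eq_of_notMem hf.2]
  rw [← Finset.sum_sdiff hsub, Finset.sum_congr rfl h1, Finset.sum_congr rfl h2,
    Finset.sum_const, Finset.sum_const, nsmul_eq_mul, nsmul_eq_mul,
    Finset.card_sdiff_of_subset hsub, Nat.cast_sub (Finset.card_le_card hsub), hq]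
  have := potential_drift t a p (G \ L).card ha hu hua
  linarith

/-- If `e`, once it has arrived, is undecided only while at least `a` candidates of `G` are
unseen, then it is postponed at most `log (|G| / a) + 3` times on average. -/
theorem expectedPostponements_le_log (M : Matroid N) (w : N → ℝ) (e : N) (G : Finset N) (a : ℕ)
    (he : e ∉ G) (ha : 1 ≤ a) (haG : a ≤ G.card)
    (h : ∀ K, e ∈ K → e ∈ undecided M w K → a ≤ (G \ K).card) :
    expectedPostponements M w e ≤ ENNReal.ofReal (Real.log ((G.card : ℝ) / a) + 3) := by
  classical
  let t := ⌈(a * (Finset.univ.erase e).card : ℝ) / G.card⌉₊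
  let φ : Finset N → ℝ := fun L => potential t a Lᶜ.card (G \ L).card
  -- while `e` is unseen, the potential refers to the other unseen candidates, and the term `1`
  -- pays for the first arrival of `e`
  let V : Finset N → ℝ := fun K => φ (insert e K) + if e ∈ K then 0 else 1
  have hφ : ∀ L, 0 ≤ φ L := fun L => potential_nonneg _ _ _ _
  have hV := expectedPostponements_le M w e V
    (fun K => add_nonneg (hφ _) (by split_ifs <;> norm_num)) ?_
  · refine hV.trans (ENNReal.ofReal_le_ofReal ?_)
    have hsub : G ⊆ Finset.univ.erase e := fun f hf =>
      Finset.mem_erase.2 ⟨fun hfe => he (hfe ▸ hf), Finset.mem_univ f⟩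
    have hb := potential_le_log ha haG (Finset.card_le_card hsub)
    have hφ0 : φ (insert e ∅) = potential t a (Finset.univ.erase e).card G.card := by
      simp only [φ]
      rw [Finset.compl_insert, Finset.compl_empty, Finset.sdiff_insert, Finset.sdiff_empty,
        Finset.erase_eq_of_notMem he]
    simp only [V, hφ0, Finset.notMem_empty, if_false]
    linarith
  intro K
  by_cases heK : e ∈ K
  · have hVK : ∀ f, V (insert f K) = φ (insert f K) := fun f => by
      simp [V, heK, Finset.insert_eq_of_mem (Finset.mem_insert_of_mem heK)]
    have hVK' : V K = φ K := by simp [V, heK]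
    simp only [hVK, hVK', Finset.insert_eq_of_mem heK]
    refine sum_potential_insert_le G K t a ha (by split_ifs <;> norm_num) ?_
    split_ifs with hund
    · rw [one_mul]; exact_mod_cast h K heK hund
    · simp
  · have hdrift := sum_potential_insert_le G (insert e K) t a ha zero_le_one (u := 0) (by simp)
    have hK : Kᶜ = insert e (insert e K)ᶜ := by
      rw [Finset.compl_insert, Finset.insert_erase (by simpa using heK)]
    have hne : e ∉ (insert e K)ᶜ := by simp
    have hVe : V (insert e K) = φ (insert e K) := by simp [V]
    have hVf : ∀ f ∈ (insert e K)ᶜ, V (insert f K) = φ (insert f (insert e K)) + 1 := by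
      intro f hf
      have hfe : e ∉ insert f K := by
        rw [Finset.mem_insert]
        rintro (rfl | h')
        exacts [hne hf, heK h']
      simp only [V, if_neg hfe, Finset.insert_comm e f K]
    have hVK : V K = φ (insert e K) + 1 := by simp [V, heK]
    rw [hVK, hK, Finset.sum_insert hne, hVe, Finset.sum_congr rfl hVf, Finset.sum_add_distrib,
      Finset.sum_const, Finset.card_insert_of_notMem hne, nsmul_eq_mul]
    have hu : (if e ∈ undecided M w (insert e K) then (1 : ℝ) else 0) ≤ 1 := by
      split_ifs <;> norm_num
    push_cast
    simp only [φ] at hdrift ⊢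
    linarith

end Potential

/-! ### Undecided candidates in a uniform matroid -/

section UniformMatroid

variable {N : Type*} [DecidableEq N]

theorem IsOptimum.card_le {r : ℕ} {w : N → ℝ} {K I : Finset N}
    (hI : IsOptimum (uniformMatroid N r) w K I) : I.card ≤ r :=
  (uniformMatroid_indep r I).1 hI.2.1

theorem IsOptimum.mem_of_lt {r : ℕ} {w : N → ℝ} {K I : Finset N}
    (hI : IsOptimum (uniformMatroid N r) w K I) {e f : N} (he : e ∈ I) (hf : f ∈ K)
    (hlt : w e < w f) : f ∈ I := by
  by_contra hfI
  have hfe : f ∉ I.erase e := fun h => hfI (Finset.mem_of_mem_erase h)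
  have h := hI.2.2 (insert f (I.erase e))
    (Finset.insert_subset hf ((Finset.erase_subset e I).trans hI.1))
    ((uniformMatroid_indep r _).2 (by
      rw [Finset.card_insert_of_notMem hfe, Finset.card_erase_add_one he]
      exact hI.card_le))
  rw [Finset.sum_insert hfe, ← Finset.add_sum_erase I w he] at h
  linarith

theorem IsOptimum.le_card [Fintype N] {r : ℕ} {w : N → ℝ} {I : Finset N}
    (hI : IsOptimum (uniformMatroid N r) w Finset.univ I) (hw : Admissible w)
    (hr : r ≤ Fintype.card N) : r ≤ I.card := by
  by_contra! hlt
  obtain ⟨f, -, hf⟩ := Finset.exists_mem_notMem_of_card_lt_card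
    (hlt.trans_le (hr.trans_eq Finset.card_univ.symm))
  have h := hI.2.2 (insert f I) (Finset.subset_univ _)
    ((uniformMatroid_indep r _).2 (by rw [Finset.card_insert_of_notMem hf]; omega))
  rw [Finset.sum_insert hf] at h
  linarith [hw.1 f]

variable [Fintype N]

/-- The candidates whose weight is larger than that of `e`. -/
noncomputable def better (w : N → ℝ) (e : N) : Finset N := Finset.univ.filter fun f => w e < w f

/-- The candidates whose weight is smaller than that of `e`. -/
noncomputable def worse (w : N → ℝ) (e : N) : Finset N := Finset.univ.filter fun f => w f < w e

omit [DecidableEq N] in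
theorem card_better_add_one (w : N → ℝ) (e : N) : (better w e).card + 1 = position w e := rfl

theorem card_worse_add_position {w : N → ℝ} (hw : Function.Injective w) (e : N) :
    (worse w e).card + position w e = Fintype.card N := by
  have hd : Disjoint (worse w e) (better w e) := by
    rw [Finset.disjoint_left]
    intro f h1 h2
    simp only [worse, better, Finset.mem_filter] at h1 h2
    exact lt_asymm h1.2 h2.2
  have he : e ∉ worse w e ∪ better w e := by simp [worse, better]
  have h : insert e (worse w e ∪ better w e) = Finset.univ := by
    ext f
    simp only [worse, better, Finset.mem_insert, Finset.mem_union, Finset.mem_filter,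
      Finset.mem_univ, true_and, iff_true]
    rcases lt_trichotomy (w f) (w e) with h | h | h
    exacts [Or.inr (Or.inl h), Or.inl (hw h), Or.inr (Or.inr h)]
  rw [← card_better_add_one, ← Finset.card_univ, ← h, Finset.card_insert_of_notMem he,
    Finset.card_union_of_disjoint hd, add_assoc]

/-- A candidate of the optimum of `K` is not preceded by `r` better ones in `K`, so all but `r - 1`
of the candidates that are better than it are unseen. -/
theorem card_better_lt_of_undecided {r : ℕ} {w : N → ℝ} {e : N} {K : Finset N} (heK : e ∈ K)
    (hund : e ∈ undecided (uniformMatroid N r) w K) :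
    (better w e).card + 1 ≤ r + (better w e \ K).card := by
  rw [mem_undecided] at hund
  obtain ⟨⟨I, hI, heI⟩, -⟩ := hund.resolve_left (not_not_intro heK)
  have hsub : insert e (better w e ∩ K) ⊆ I := by
    refine Finset.insert_subset heI fun f hf => ?_
    obtain ⟨h1, h2⟩ := Finset.mem_inter.1 hf
    exact hI.mem_of_lt heI h2 (Finset.mem_filter.1 h1).2
  have hne : e ∉ better w e ∩ K := by simp [better]
  have h := (Finset.card_le_card hsub).trans hI.card_le
  rw [Finset.card_insert_of_notMem hne] at h
  have := Finset.card_inter_add_card_sdiff (better w e) K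
  omega

/-- If weights of the unseen candidates force `e` out of the optimum, then the optimum consists of
`r` candidates that precede `e`, each of which was better from the start or is unseen. -/
theorem le_card_better_add_of_undecided {r : ℕ} {w : N → ℝ} (hw : Admissible w)
    (hr : r ≤ Fintype.card N) {e : N} {K : Finset N} (heK : e ∈ K)
    (hund : e ∈ undecided (uniformMatroid N r) w K) :
    r ≤ (better w e).card + (worse w e \ K).card := by
  rw [mem_undecided] at hund
  obtain ⟨-, w', hw', hag, I, hI, heI⟩ := hund.resolve_left (not_not_intro heK)
  have hsub : I ⊆ better w e ∪ (worse w e \ K) := by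
    intro f hf
    have hfe : f ≠ e := fun h => heI (h ▸ hf)
    have hle : w' e ≤ w' f := by
      by_contra! hlt
      exact heI (hI.mem_of_lt hf (Finset.mem_univ e) hlt)
    have hlt : w' e < w' f := lt_of_le_of_ne hle fun h => hfe (hw'.2 h.symm)
    simp only [worse, better, Finset.mem_union, Finset.mem_sdiff, Finset.mem_filter,
      Finset.mem_univ, true_and]
    by_cases hfK : f ∈ K
    · rw [hag e heK, hag f hfK] at hlt
      exact Or.inl hlt
    · rcases lt_or_gt_of_ne fun h => hfe (hw.2 h) with h | h
      exacts [Or.inr ⟨h, hfK⟩, Or.inl h]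
  exact (hI.le_card hw' hr).trans ((Finset.card_le_card hsub).trans (Finset.card_union_le _ _))

end UniformMatroid

end Postponing

theorem mainTheorem6 :
    ∃ C : ℝ, ∀ (n r : ℕ), 1 ≤ r → 2 * r ≤ n →
      ∀ w : Fin n → ℝ, Postponing.Admissible w →
        ∀ (e : Fin n) (j : ℕ), Postponing.position w e = j →
          (j ≤ r →
            Postponing.expectedPostponements (Postponing.uniformMatroid (Fin n) r) w e ≤
              ENNReal.ofReal (Real.log (((n : ℝ) - j) / ((r : ℝ) - j + 1)) + C)) ∧
          (r < j →
            Postponing.expectedPostponements (Postponing.uniformMatroid (Fin n) r) w e ≤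
              ENNReal.ofReal (Real.log (((j : ℝ) - 1) / ((j : ℝ) - r)) + C)) := by
  refine ⟨3, fun n r hr hrn w hw e j hj => ?_⟩
  have hB := (Postponing.card_better_add_one w e).trans hj
  have hW := Postponing.card_worse_add_position hw.2 e
  rw [hj, Fintype.card_fin] at hW
  refine ⟨fun hjr => ?_, fun hrj => ?_⟩
  · have h := Postponing.expectedPostponements_le_log (Postponing.uniformMatroid (Fin n) r) w e
      (Postponing.worse w e) (r + 1 - j) (by simp [Postponing.worse]) (by omega) (by omega)
      fun K heK hund => by
        have := Postponing.le_card_better_add_of_undecided hw (by rw [Fintype.card_fin]; omega)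
          heK hund
        omega
    have hs : ((Postponing.worse w e).card : ℝ) = n - j :=
      eq_sub_of_add_eq (by exact_mod_cast hW)
    have ha : ((r + 1 - j : ℕ) : ℝ) = r - j + 1 := by
      rw [Nat.cast_sub (by omega)]; push_cast; ring
    rwa [hs, ha] at h
  · have h := Postponing.expectedPostponements_le_log (Postponing.uniformMatroid (Fin n) r) w e
      (Postponing.better w e) (j - r) (by simp [Postponing.better]) (by omega) (by omega)
      fun K heK hund => by
        have := Postponing.card_better_lt_of_undecided heK hund
        omega
    have hs : ((Postponing.better w e).card : ℝ) = j - 1 :=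
      eq_sub_of_add_eq (by exact_mod_cast hB)
    rwa [hs, Nat.cast_sub hrj.le] at h
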